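/- Let $p$ be a prime number, let $G$ be a $p$-adic analytic group (i.e. a $p$-adic Lie group: a group which is a finite-dimensional analytic manifold over $\mathbb{Q}_p$ with analytic multiplication and inversion; $G$ is not assumed to be compact), and let $k$ be a field of positive characteristic, not necessarily equal to $p$. Let $\mathrm{Rep}_k(G)$ be the category of all $k$-linear representations of $G$, and let $\mathrm{Rep}_k^{\mathrm{sm}}(G)$ be its full subcategory of smooth representations, that is, of those representations $V$ for which the action map $G\times V\to V$ is continuous when $V$ carries the discrete topology. Then for all smooth representations $V, W\in \mathrm{Rep}_k^{\mathrm{sm}}(G)$ one has $$\mathrm{Ext}^1_{\mathrm{Rep}_k^{\mathrm{sm}}(G)}(V,W) = \mathrm{Ext}^1_{\mathrm{Rep}_k(G)}(V,W),$$ in the sense that the canonical $k$-linear map from the left-hand side to the right-hand side induced by the exact inclusion functor $\mathrm{Rep}_k^{\mathrm{sm}}(G)\hookrightarrow \mathrm{Rep}_k(G)$ is an isomorphism. -/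

import Mathlib

open CategoryTheory CategoryTheory.Limits
open scoped Manifold ContDiff

universe w₁ w₂ w v u

/-- A representation `V` of a topological group `G` is smooth if the action map `G × V → V` is
continuous when `V` carries the discrete topology. -/
def smoothProperty (k : Type u) (G : Type v) [Field k] [Group G] [TopologicalSpace G] :
    ObjectProperty (Rep.{w} k G) :=
  fun V => letI : TopologicalSpace V := ⊥; Continuous fun x : G × V => V.ρ x.1 x.2

/-- The category of smooth representations of `G` over `k`, as a full subcategory of the category
of all representations. -/
abbrev SmoothRep (k : Type u) (G : Type v) [Field k] [Group G] [TopologicalSpace G] :=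
  (smoothProperty.{w} k G).FullSubcategory

section

variable {k : Type u} {G : Type v} [Field k] [Group G] [TopologicalSpace G]

/-- Smoothness, rephrased: all orbit maps are locally constant. -/
lemma smoothProperty_iff (V : Rep.{w} k G) :
    smoothProperty k G V ↔ ∀ x : V, IsLocallyConstant fun g : G => V.ρ g x := by
  let _ : TopologicalSpace V := ⊥
  have : DiscreteTopology V := ⟨rfl⟩
  change (Continuous fun x : G × V => V.ρ x.1 x.2) ↔ _
  rw [continuous_prod_of_discrete_right]
  exact forall_congr' fun x => (IsLocallyConstant.iff_continuous _).symm

instance : (smoothProperty.{w} k G).IsClosedUnderSubobjects where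
  prop_of_mono {X Y} f _ hY := by
    rw [smoothProperty_iff] at hY ⊢
    intro x
    have hf := (Rep.mono_iff_injective f).1 inferInstance
    refine IsLocallyConstant.desc (fun g => X.ρ g x) f.hom ?_ hf
    have : (f.hom ∘ fun g => X.ρ g x) = fun g => Y.ρ g (f.hom x) :=
      funext fun g => Rep.hom_comm_apply f g x
    rw [this]
    exact hY _

instance : (smoothProperty.{w} k G).IsClosedUnderQuotients where
  prop_of_epi {X Y} f _ hX := by
    rw [smoothProperty_iff] at hX ⊢
    intro y
    obtain ⟨x, rfl⟩ := (Rep.epi_iff_surjective f).1 inferInstance y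
    have : (fun g => Y.ρ g (f.hom x)) = f.hom ∘ fun g => X.ρ g x :=
      funext fun g => (Rep.hom_comm_apply f g x).symm
    rw [this]
    exact (hX x).comp _

instance : (smoothProperty.{w} k G).ContainsZero where
  exists_zero := by
    obtain ⟨Z, hZ⟩ := HasZeroObject.zero (C := Rep.{w} k G)
    refine ⟨Z, hZ, ?_⟩
    have := (Rep.isZero_iff k G Z).1 hZ
    rw [smoothProperty_iff]
    exact fun x => IsLocallyConstant.iff_exists_open _ |>.2 fun g =>
      ⟨Set.univ, isOpen_univ, trivial, fun _ _ => Subsingleton.elim _ _⟩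

instance : (smoothProperty.{w} k G).IsClosedUnderBinaryProducts where
  limitsOfShape_le := by
    rintro X ⟨p⟩
    let F := p.diag
    let A := F.obj ⟨WalkingPair.left⟩
    let B := F.obj ⟨WalkingPair.right⟩
    have hA : smoothProperty k G A := p.prop_diag_obj _
    have hB : smoothProperty k G B := p.prop_diag_obj _
    let p1 : X ⟶ A := p.π.app ⟨WalkingPair.left⟩
    let p2 : X ⟶ B := p.π.app ⟨WalkingPair.right⟩
    let c : Cone F := ⟨A ⊞ B, {
      app := fun j => match j with
        | ⟨WalkingPair.left⟩ => biprod.fst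
        | ⟨WalkingPair.right⟩ => biprod.snd
      naturality := by
        rintro ⟨i⟩ ⟨j⟩ ⟨⟨h⟩⟩
        obtain rfl : i = j := h
        simp [Discrete.functor_map_id] }⟩
    let s : A ⊞ B ⟶ X := p.isLimit.lift c
    have hs1 : s ≫ p1 = biprod.fst := p.isLimit.fac c ⟨WalkingPair.left⟩
    have hs2 : s ≫ p2 = biprod.snd := p.isLimit.fac c ⟨WalkingPair.right⟩
    have hid : p1 ≫ biprod.inl ≫ s + p2 ≫ biprod.inr ≫ s = 𝟙 X := by
      refine p.isLimit.hom_ext ?_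
      rintro ⟨_ | _⟩
      · change (_ + _) ≫ p1 = _ ≫ p1
        simp [hs1]
      · change (_ + _) ≫ p2 = _ ≫ p2
        simp [hs2]
    rw [smoothProperty_iff] at hA hB ⊢
    intro x
    let i1 : A ⟶ X := biprod.inl ≫ s
    let i2 : B ⟶ X := biprod.inr ≫ s
    have key : ∀ y : X, i1.hom (p1.hom y) + i2.hom (p2.hom y) = y := fun y => by
      have := congrArg (fun f : X ⟶ X => f.hom y) hid
      simpa [i1, i2, Rep.add_hom] using this
    have : (fun g => X.ρ g x) =
        (fun g => i1.hom (A.ρ g (p1.hom x))) + fun g => i2.hom (B.ρ g (p2.hom x)) := by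
      funext g
      rw [Pi.add_apply, ← Rep.hom_comm_apply, ← Rep.hom_comm_apply, key]
    rw [this]
    exact ((hA _).comp i1.hom).add ((hB _).comp i2.hom)

instance : (smoothProperty.{w} k G).IsClosedUnderFiniteProducts :=
  ObjectProperty.IsClosedUnderFiniteProducts.mk'

instance : PreservesFiniteLimits (smoothProperty.{w} k G).ι :=
  haveI := (smoothProperty.{w} k G).preservesKernels_ι
  Functor.preservesFiniteLimits_of_preservesKernels _

instance : PreservesFiniteColimits (smoothProperty.{w} k G).ι :=
  haveI := (smoothProperty.{w} k G).preservesCokernels_ι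
  Functor.preservesFiniteColimits_of_preservesCokernels _

end

/-! Classes in `Ext¹` come from short exact sequences, so a full exact subcategory closed under
extensions has the same `Ext¹`. It remains to show that an extension `E` of smooth representations
is smooth: every stabilizer in `E` is open. Near the identity, `a ↦ ρ a x - x` takes values in the
smooth subrepresentation, but no continuity of this cocycle is known. On the procyclic group of a
single `g`, commutativity turns the cocycle, after passing to a power of `g`, into a map with `ρ
(bⁿ) x = x + n (ρ b x - x)`. Positive characteristic `ℓ` then forces all `ℓ`-th powers to fix `x`
(`exists_closure_powers_subset_fixer`). Finally, `d` such procyclic groups along the coordinate axes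
multiply out to a neighbourhood of the identity (`subgroup_mem_nhds_one`), by successive `p`-adic
approximation and compactness. -/

/-! ### `Ext¹` and short exact sequences -/

section

open Abelian DerivedCategory Pretriangulated

attribute [local instance] HasDerivedCategory.standard

/-- Every class in `Ext¹` is the class of a short exact sequence. -/
lemma exists_extClass_eq {C : Type u} [Category.{v} C] [Abelian C] [HasExt.{w} C] {X Y : C}
    (e : Ext X Y 1) :
    ∃ (E : C) (f : Y ⟶ E) (g : E ⟶ X) (w : f ≫ g = 0)
      (h : (ShortComplex.mk f g w).ShortExact), h.extClass = e := by
  obtain ⟨Z, f', g', hT⟩ := distinguished_cocone_triangle₂ (C := DerivedCategory C) e.hom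
  -- Both outer terms of the triangle sit in degree 0, hence so does `Z`, which therefore comes from
  -- an object of `C`.
  have hle : Z.IsLE 0 := TStructure.t.isLE₂ _ hT 0
    (inferInstanceAs (((singleFunctor C 0).obj Y).IsLE 0))
    (inferInstanceAs (((singleFunctor C 0).obj X).IsLE 0))
  have hge : Z.IsGE 0 := TStructure.t.isGE₂ _ hT 0
    (inferInstanceAs (((singleFunctor C 0).obj Y).IsGE 0))
    (inferInstanceAs (((singleFunctor C 0).obj X).IsGE 0))
  obtain ⟨E, ⟨i⟩⟩ := exists_iso_singleFunctor_obj_of_isGE_of_isLE Z 0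
  obtain ⟨f, hf⟩ := (singleFunctor C 0).map_surjective (f' ≫ i.hom)
  obtain ⟨g, hg⟩ := (singleFunctor C 0).map_surjective (i.inv ≫ g')
  replace hT : Triangle.mk ((singleFunctor C 0).map f) ((singleFunctor C 0).map g) e.hom ∈
      distTriang (DerivedCategory C) := by
    refine isomorphic_distinguished _ hT _ (Triangle.isoMk _ _ (Iso.refl _) i.symm (Iso.refl _)
      ?_ ?_ ?_)
    · change (singleFunctor C 0).map f ≫ i.inv = 𝟙 _ ≫ f'
      simp [hf]
    · change (singleFunctor C 0).map g ≫ 𝟙 _ = i.inv ≫ g'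
      simp [hg]
    · change e.hom ≫ (𝟙 ((singleFunctor C 0).obj Y))⟦(1 : ℤ)⟧' = 𝟙 _ ≫ e.hom
      simp
  have w : f ≫ g = 0 := (singleFunctor C 0).map_injective (by
    rw [Functor.map_comp, Functor.map_zero]
    exact comp_distTriang_mor_zero₁₂ _ hT)
  have hmono : Mono f := by
    refine Preadditive.mono_of_cancel_zero _ fun {A} t ht => ?_
    apply (singleFunctor C 0).map_injective
    obtain ⟨a, ha⟩ := Triangle.coyoneda_exact₂ _ (inv_rot_of_distTriang _ hT)
      ((singleFunctor C 0).map t) (by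
        change _ ≫ (singleFunctor C 0).map f = 0
        rw [← Functor.map_comp, ht, Functor.map_zero])
    -- A test map killed by `f` factors through `X[-1]`, which lives in degree 1 and receives no
    -- nonzero map from degree 0.
    have : TStructure.t.IsGE (((singleFunctor C 0).obj X)⟦(-1 : ℤ)⟧) 1 :=
      TStructure.t.isGE_shift _ 0 (-1) 1
    have ha0 : a = 0 := TStructure.t.zero (Y := ((singleFunctor C 0).obj X)⟦(-1 : ℤ)⟧) a 0 1
    rw [ha, ha0]
    exact zero_comp.trans (Functor.map_zero _ _ _).symm
  have hepi : Epi g := by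
    refine Preadditive.epi_of_cancel_zero _ fun {A} t ht => ?_
    apply (singleFunctor C 0).map_injective
    obtain ⟨a, ha⟩ := Triangle.yoneda_exact₃ _ hT ((singleFunctor C 0).map t) (by
        change (singleFunctor C 0).map g ≫ _ = 0
        rw [← Functor.map_comp, ht, Functor.map_zero])
    have : TStructure.t.IsLE (((singleFunctor C 0).obj Y)⟦(1 : ℤ)⟧) (-1) :=
      TStructure.t.isLE_shift _ 0 1 (-1)
    have ha0 : a = 0 := TStructure.t.zero (X := ((singleFunctor C 0).obj Y)⟦(1 : ℤ)⟧) a (-1) 0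
    rw [ha, ha0]
    exact (comp_zero (X := (singleFunctor C 0).obj X)).trans (Functor.map_zero _ _ _).symm
  have hex : (ShortComplex.mk f g w).ShortExact :=
    { exact := by
        refine ShortComplex.exact_of_f_is_kernel _ (KernelFork.IsLimit.ofι' _ _ fun {A} k hk => ?_)
        have := Triangle.coyoneda_exact₂ _ hT ((singleFunctor C 0).map k) (by
          change _ ≫ (singleFunctor C 0).map g = 0
          rw [← Functor.map_comp, hk, Functor.map_zero])
        refine ⟨(singleFunctor C 0).preimage this.choose, (singleFunctor C 0).map_injective ?_⟩
        rw [Functor.map_comp]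
        exact (congrArg (CategoryStruct.comp · ((singleFunctor C 0).map f))
          ((singleFunctor C 0).map_preimage this.choose)).trans this.choose_spec.symm }
  refine ⟨E, f, g, w, hex, ?_⟩
  ext
  rw [hex.extClass_hom]
  -- Both triangles have the same first two maps. The comparison on `X` is the identity because `g`
  -- is epi, so the connecting maps agree.
  obtain ⟨c, hc₁, hc₂⟩ := complete_distinguished_triangle_morphism _ _
    hex.singleTriangle_distinguished hT (𝟙 _) (𝟙 _)
    ((Category.comp_id _).trans (Category.id_comp _).symm)
  obtain ⟨c', rfl⟩ := (singleFunctor C 0).map_surjective c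
  have hc' : c' = 𝟙 X := by
    rw [← cancel_epi g, Category.comp_id]
    apply (singleFunctor C 0).map_injective
    rw [Functor.map_comp]
    exact hc₁.trans (Category.id_comp _)
  subst hc'
  refine Eq.trans ?_ (hc₂.trans ?_)
  · change _ = hex.singleδ ≫ (𝟙 ((singleFunctor C 0).obj Y))⟦(1 : ℤ)⟧'
    simp
  · change (singleFunctor C 0).map (𝟙 X) ≫ e.hom = _
    simp

/-- The inclusion of a full exact abelian subcategory induces an injection on `Ext¹`. -/
lemma mapExactFunctor_one_injective {C : Type*} [Category C] [Abelian C] {D : Type*} [Category D]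
    [Abelian D] (F : C ⥤ D) [F.Additive] [PreservesFiniteLimits F] [PreservesFiniteColimits F]
    [F.Full] [F.Faithful] [HasExt.{w₁} C] [HasExt.{w₂} D] (X Y : C) :
    Function.Injective (Ext.mapExactFunctor F : Ext.{w₁} X Y 1 → _) := by
  suffices ∀ e : Ext.{w₁} X Y 1, e.mapExactFunctor F = 0 → e = 0 from
    (injective_iff_map_eq_zero (F.mapExtAddHom X Y 1)).2 this
  intro e he
  obtain ⟨E, f, g, w, h, rfl⟩ := exists_extClass_eq e
  rw [Ext.mapExactFunctor_extClass] at he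
  -- A vanishing class lets the identity lift to a section of `F.map g`; by fullness the section
  -- descends to `C`.
  obtain ⟨s, hs⟩ := Ext.covariant_sequence_exact₃ _ (h.map_of_exact F)
    (Ext.mk₀ (𝟙 (F.obj X))) (zero_add 1) (by
      rw [he]
      exact Ext.comp_zero (Ext.mk₀ (𝟙 (F.obj X))) (F.obj Y) 1 1 (zero_add 1))
  obtain ⟨s, rfl⟩ := (Ext.mk₀_bijective _ _).2 s
  obtain ⟨s, rfl⟩ := F.map_surjective s
  replace hs : s ≫ g = 𝟙 X := by
    apply F.map_injective
    rw [F.map_comp, F.map_id]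
    exact (Ext.mk₀_bijective _ _).1 ((Ext.mk₀_comp_mk₀ _ _).symm.trans hs)
  have : (Ext.mk₀ (s ≫ g)).comp h.extClass (zero_add 1) = 0 := by
    rw [← Ext.mk₀_comp_mk₀_assoc]
    exact (congrArg ((Ext.mk₀ s).comp · (zero_add 1)) h.comp_extClass).trans
      (Ext.comp_zero _ _ _ _ _)
  rwa [hs, Ext.mk₀_id_comp] at this

/-- The inclusion of a full exact abelian subcategory that is closed under extensions induces a
surjection on `Ext¹`. -/
lemma mapExactFunctor_one_surjective {D : Type*} [Category D] [Abelian D] (P : ObjectProperty D)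
    [P.IsClosedUnderSubobjects] [P.IsClosedUnderQuotients] [P.ContainsZero]
    [P.IsClosedUnderFiniteProducts] [PreservesFiniteLimits P.ι] [PreservesFiniteColimits P.ι]
    [P.IsClosedUnderExtensions] [HasExt.{w₁} P.FullSubcategory] [HasExt.{w₂} D]
    (X Y : P.FullSubcategory) :
    Function.Surjective (Ext.mapExactFunctor P.ι : Ext.{w₁} X Y 1 → _) := by
  intro e
  obtain ⟨E, f, g, w, h, rfl⟩ := exists_extClass_eq e
  let E' : P.FullSubcategory := ⟨E, P.prop_X₂_of_shortExact h Y.property X.property⟩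
  let S : ShortComplex P.FullSubcategory :=
    ShortComplex.mk (P.homMk f : Y ⟶ E') (P.homMk g : E' ⟶ X) (P.ι.map_injective w)
  have hS : S.ShortExact :=
    { exact := (ShortComplex.exact_map_iff_of_faithful S P.ι).1 h.exact
      mono_f := P.ι.mono_of_mono_map h.mono_f
      epi_g := P.ι.epi_of_epi_map h.epi_g }
  exact ⟨hS.extClass, Ext.mapExactFunctor_extClass _ hS⟩

end

/-! ### Coordinates on a Lie group -/

/-- Around the identity, a Lie group over a complete field admits coordinates in which the
multiplication is strictly differentiable with derivative the addition. -/
lemma LieGroup.exists_coordinates (𝕜 : Type*) [NontriviallyNormedField 𝕜] [CompleteSpace 𝕜]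
    {E : Type*} [NormedAddCommGroup E] [NormedSpace 𝕜 E] [CompleteSpace E]
    (G : Type*) [Group G] [TopologicalSpace G] [ChartedSpace E G] [LieGroup 𝓘(𝕜, E) ω G] :
    ∃ ψ : OpenPartialHomeomorph G E, 1 ∈ ψ.source ∧ ψ 1 = 0 ∧
      HasStrictFDerivAt (fun z : E × E => ψ (ψ.symm z.1 * ψ.symm z.2))
        (ContinuousLinearMap.fst 𝕜 E E + ContinuousLinearMap.snd 𝕜 E E) (0, 0) := by
  have : IsTopologicalGroup G := topologicalGroup_of_lieGroup 𝓘(𝕜, E) ω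
  let φ : OpenPartialHomeomorph G E := chartAt E 1
  let ψ := φ.transHomeomorph (Homeomorph.addRight (-φ 1))
  have h1 : (1 : G) ∈ ψ.source := mem_chart_source E 1
  have hψ1 : ψ 1 = 0 := by simp [ψ]
  refine ⟨ψ, h1, hψ1, ?_⟩
  have hdiff : ContDiffAt 𝕜 ω (fun z : E × E => φ (φ.symm z.1 * φ.symm z.2)) (φ 1, φ 1) := by
    have h := (contMDiffAt_iff.1
      ((contMDiff_mul 𝓘(𝕜, E) ω).contMDiffAt (x := ((1 : G), (1 : G))))).2
    simp only [mfld_simps, Function.comp_def] at h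
    simpa using! h
  have hstrict : HasStrictFDerivAt (fun z : E × E => ψ (ψ.symm z.1 * ψ.symm z.2))
      (fderiv 𝕜 (fun z : E × E => ψ (ψ.symm z.1 * ψ.symm z.2)) (0, 0)) (0, 0) := by
    have h2 : ContDiffAt 𝕜 ω (fun z : E × E => ψ (ψ.symm z.1 * ψ.symm z.2)) (0, 0) := by
      have : (fun z : E × E => ψ (ψ.symm z.1 * ψ.symm z.2)) =
          fun z => ((fun z : E × E => φ (φ.symm z.1 * φ.symm z.2)) ∘
            fun z => (z.1 + φ 1, z.2 + φ 1)) z - φ 1 := by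
        funext z
        simp [ψ, sub_eq_add_neg, Homeomorph.addRight_symm]
      rw [this]
      refine ContDiffAt.sub (ContDiffAt.comp _ ?_ ?_) contDiffAt_const
      · simpa using hdiff
      · exact ((contDiff_fst.add contDiff_const).prodMk
          (contDiff_snd.add contDiff_const)).contDiffAt
    exact (ContDiffAt.analyticAt h2).hasStrictFDerivAt
  have hsymm : ψ.symm 0 = 1 := by rw [← hψ1, ψ.left_inv h1]
  have ht : ∀ᶠ z : E in nhds 0, z ∈ ψ.target := by
    refine ψ.open_target.mem_nhds ?_
    rw [← hψ1]
    exact ψ.map_source h1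
  convert hstrict using 1
  set L := fderiv 𝕜 (fun z : E × E => ψ (ψ.symm z.1 * ψ.symm z.2)) (0, 0)
  -- The derivative is determined on the two axes, where one factor is the identity of `G`.
  have hL1 : L.comp (ContinuousLinearMap.inl 𝕜 E E) = ContinuousLinearMap.id 𝕜 E := by
    refine HasFDerivAt.unique (x := (0 : E)) (f := fun z => ψ (ψ.symm z * ψ.symm 0)) ?_ ?_
    · exact HasFDerivAt.comp (g := fun z : E × E => ψ (ψ.symm z.1 * ψ.symm z.2))
        (f := fun e : E => (e, (0 : E))) (0 : E)
        hstrict.hasFDerivAt (hasFDerivAt_prodMk_left (0 : E) (0 : E))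
    · refine (hasFDerivAt_id (0 : E)).congr_of_eventuallyEq ?_
      filter_upwards [ht] with z hz
      simp [hsymm, ψ.right_inv hz]
  have hL2 : L.comp (ContinuousLinearMap.inr 𝕜 E E) = ContinuousLinearMap.id 𝕜 E := by
    refine HasFDerivAt.unique (x := (0 : E)) (f := fun z => ψ (ψ.symm 0 * ψ.symm z)) ?_ ?_
    · exact HasFDerivAt.comp (g := fun z : E × E => ψ (ψ.symm z.1 * ψ.symm z.2))
        (f := fun e : E => ((0 : E), e)) (0 : E)
        hstrict.hasFDerivAt (hasFDerivAt_prodMk_right (0 : E) (0 : E))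
    · refine (hasFDerivAt_id (0 : E)).congr_of_eventuallyEq ?_
      filter_upwards [ht] with z hz
      simp [hsymm, ψ.right_inv hz]
  ext z
  · simpa using (DFunLike.congr_fun hL1 z).symm
  · simpa using (DFunLike.congr_fun hL2 z).symm

/-! ### Powers and products in almost additive coordinates -/

section

variable {p : ℕ} [Fact p.Prime] {d : ℕ} {G : Type*} [Group G] [TopologicalSpace G]

/-- The set of elements of `G` whose coordinates have norm at most `r`. -/
def coordinateBall (ψ : OpenPartialHomeomorph G (Fin d → ℚ_[p])) (r : ℝ) : Set G :=
  {g | g ∈ ψ.source ∧ ‖ψ g‖ ≤ r}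

/-- Coordinates around the identity of `G` in which, on the ball of radius `r`, the multiplication
differs from the addition by a map that contracts distances by the factor `p⁻²`. -/
structure IsAlmostAdditive (ψ : OpenPartialHomeomorph G (Fin d → ℚ_[p])) (r : ℝ) : Prop where
  nonneg : 0 ≤ r
  one_mem_source : 1 ∈ ψ.source
  map_one : ψ 1 = 0
  closedBall_subset : Metric.closedBall 0 r ⊆ ψ.target
  mul_mem_source : ∀ ⦃x y⦄, x ∈ coordinateBall ψ r → y ∈ coordinateBall ψ r → x * y ∈ ψ.source
  norm_mul_sub_mul : ∀ ⦃x y x' y'⦄, x ∈ coordinateBall ψ r → y ∈ coordinateBall ψ r →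
    x' ∈ coordinateBall ψ r → y' ∈ coordinateBall ψ r →
    ‖ψ (x * y) - ψ (x' * y') - ((ψ x - ψ x') + (ψ y - ψ y'))‖ ≤
      (p : ℝ)⁻¹ ^ 2 * max ‖ψ x - ψ x'‖ ‖ψ y - ψ y'‖

/-- Strict differentiability, with error constant `p⁻²`, is the required contraction estimate on a
small ball. The radius is taken of the form `‖c‖` so that the vectors `c • eᵢ` lie in the ball. -/
lemma LieGroup.exists_isAlmostAdditive [ChartedSpace (Fin d → ℚ_[p]) G]
    [LieGroup 𝓘(ℚ_[p], Fin d → ℚ_[p]) ω G] {U : Set G} (hU : U ∈ nhds 1) :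
    ∃ (ψ : OpenPartialHomeomorph G (Fin d → ℚ_[p])) (c : ℚ_[p]), c ≠ 0 ∧
      IsAlmostAdditive ψ ‖c‖ ∧ coordinateBall ψ ‖c‖ ⊆ U := by
  have : IsTopologicalGroup G := topologicalGroup_of_lieGroup 𝓘(ℚ_[p], Fin d → ℚ_[p]) ω
  obtain ⟨ψ, h1, hψ1, hψ⟩ := LieGroup.exists_coordinates ℚ_[p] (E := Fin d → ℚ_[p]) G
  have hp : (0 : ℝ) < (p : ℝ)⁻¹ ^ 2 := by
    have := (Fact.out : p.Prime).pos
    positivity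
  have h0t : (0 : Fin d → ℚ_[p]) ∈ ψ.target := hψ1 ▸ ψ.map_source h1
  have hs0 : ψ.symm 0 = 1 := by rw [← hψ1, ψ.left_inv h1]
  have hcs : ContinuousAt ψ.symm 0 := ψ.symm.continuousAt h0t
  have ev1 := (hasStrictFDerivAt_iff_isLittleO.1 hψ).def hp
  have ev2 : ∀ᶠ z : (Fin d → ℚ_[p]) × (Fin d → ℚ_[p]) in nhds (0, 0),
      ψ.symm z.1 * ψ.symm z.2 ∈ ψ.source := by
    have hc : ContinuousAt (fun z : (Fin d → ℚ_[p]) × (Fin d → ℚ_[p]) =>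
        ψ.symm z.1 * ψ.symm z.2) (0, 0) :=
      (ContinuousAt.comp (f := Prod.fst) (g := ψ.symm) hcs continuousAt_fst).mul
        (ContinuousAt.comp (f := Prod.snd) (g := ψ.symm) hcs continuousAt_snd)
    refine hc.eventually_mem (ψ.open_source.mem_nhds ?_)
    simpa [hs0] using h1
  have ev3 : ∀ᶠ z in nhds (0 : Fin d → ℚ_[p]), z ∈ ψ.target ∧ ψ.symm z ∈ U :=
    (ψ.open_target.eventually_mem h0t).and (hcs.eventually_mem (by rwa [hs0]))
  obtain ⟨δ₁, hδ₁, H1⟩ := Metric.eventually_nhds_iff.1 ev1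
  obtain ⟨δ₂, hδ₂, H2⟩ := Metric.eventually_nhds_iff.1 ev2
  obtain ⟨δ₃, hδ₃, H3⟩ := Metric.eventually_nhds_iff.1 ev3
  obtain ⟨c, hc0, hc⟩ := NormedField.exists_norm_lt ℚ_[p] (lt_min hδ₁ (lt_min hδ₂ hδ₃))
  obtain ⟨hc1, hc2, hc3⟩ : ‖c‖ < δ₁ ∧ ‖c‖ < δ₂ ∧ ‖c‖ < δ₃ := by simpa using hc
  refine ⟨ψ, c, norm_pos_iff.1 hc0, ⟨norm_nonneg _, h1, hψ1, ?_, ?_, ?_⟩, ?_⟩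
  · intro z hz
    exact (H3 (lt_of_le_of_lt hz hc3)).1
  · intro x y hx hy
    have := @H2 (ψ x, ψ y) (by
      simpa [Prod.dist_eq] using ⟨hx.2.trans_lt hc2, hy.2.trans_lt hc2⟩)
    simpa [ψ.left_inv hx.1, ψ.left_inv hy.1] using this
  · intro x y x' y' hx hy hx' hy'
    have := @H1 ((ψ x, ψ y), (ψ x', ψ y')) (by
      simpa [Prod.dist_eq] using ⟨⟨hx.2.trans_lt hc1, hy.2.trans_lt hc1⟩,
        hx'.2.trans_lt hc1, hy'.2.trans_lt hc1⟩)
    simpa [ψ.left_inv hx.1, ψ.left_inv hy.1, ψ.left_inv hx'.1, ψ.left_inv hy'.1,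
      Prod.norm_def] using this
  · intro x hx
    have := (@H3 (ψ x) (by simpa using hx.2.trans_lt hc3)).2
    rwa [ψ.left_inv hx.1] at this

/-- Density of `ℕ` in `ℤ_[p]`, applied to `y / a`. -/
lemma Padic.exists_nat_norm_sub_mul_le {a y : ℚ_[p]} (h : ‖y‖ ≤ ‖a‖) :
    ∃ n : ℕ, ‖n * a - y‖ ≤ (p : ℝ)⁻¹ * ‖a‖ := by
  have hp : (0 : ℝ) < (p : ℝ)⁻¹ := by
    have := (Fact.out : p.Prime).pos
    positivity
  rcases eq_or_ne a 0 with rfl | ha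
  · exact ⟨0, by simpa using h⟩
  · have ha' : 0 < ‖a‖ := norm_pos_iff.2 ha
    obtain ⟨x, hx⟩ : ∃ x : ℤ_[p], (x : ℚ_[p]) = y / a :=
      ⟨⟨y / a, by rw [norm_div]; exact div_le_one_of_le₀ h ha'.le⟩, rfl⟩
    obtain ⟨n, hn⟩ := PadicInt.denseRange_natCast.exists_dist_lt x hp
    refine ⟨n, ?_⟩
    rw [dist_comm, dist_eq_norm, PadicInt.norm_def] at hn
    push_cast at hn
    rw [hx] at hn
    have : (n : ℚ_[p]) * a - y = (n - y / a) * a := by field_simp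
    rw [this, norm_mul]
    gcongr

namespace IsAlmostAdditive

variable {ψ : OpenPartialHomeomorph G (Fin d → ℚ_[p])} {r : ℝ} (h : IsAlmostAdditive ψ r)
include h

lemma one_mem : 1 ∈ coordinateBall ψ r :=
  ⟨h.one_mem_source, by simpa [h.map_one] using h.nonneg⟩

lemma norm_mul_sub {x v : G} (hx : x ∈ coordinateBall ψ r) (hv : v ∈ coordinateBall ψ r) :
    ‖ψ (x * v) - ψ x - ψ v‖ ≤ (p : ℝ)⁻¹ ^ 2 * ‖ψ v‖ := by
  simpa [h.map_one] using h.norm_mul_sub_mul hx hv hx h.one_mem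

omit h in
lemma inv_sq_le_inv : (p : ℝ)⁻¹ ^ 2 ≤ (p : ℝ)⁻¹ := by
  have : (1 : ℝ) ≤ p := by exact_mod_cast (Fact.out : p.Prime).one_le
  exact pow_le_of_le_one (by positivity) (inv_le_one_of_one_le₀ this) two_ne_zero

omit h in
lemma inv_sq_le_one : (p : ℝ)⁻¹ ^ 2 ≤ 1 := by
  have : (1 : ℝ) ≤ p := by exact_mod_cast (Fact.out : p.Prime).one_le
  exact pow_le_one₀ (by positivity) (inv_le_one_of_one_le₀ this)

omit h in
lemma norm_le_of_norm_sub_le {V : Type*} [SeminormedAddCommGroup V] [IsUltrametricDist V]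
    {x y : V} {t : ℝ} (hxy : ‖x - y‖ ≤ t) (hy : ‖y‖ ≤ t) : ‖x‖ ≤ t := by
  rw [← sub_add_cancel x y]
  exact (IsUltrametricDist.norm_add_le_max _ _).trans (max_le hxy hy)

lemma mul_mem {x y : G} (hx : x ∈ coordinateBall ψ r) (hy : y ∈ coordinateBall ψ r) :
    x * y ∈ coordinateBall ψ r := by
  refine ⟨h.mul_mem_source hx hy, norm_le_of_norm_sub_le (y := ψ x + ψ y) ?_
    ((IsUltrametricDist.norm_add_le_max _ _).trans (max_le hx.2 hy.2))⟩
  rw [← sub_sub]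
  refine (h.norm_mul_sub hx hy).trans ?_
  exact (mul_le_of_le_one_left (norm_nonneg _) inv_sq_le_one).trans hy.2

lemma pow_mem {g : G} (hg : g ∈ coordinateBall ψ r) (k : ℕ) : g ^ k ∈ coordinateBall ψ r := by
  induction k with
  | zero => simpa using h.one_mem
  | succ k ih => rw [pow_succ]; exact h.mul_mem ih hg

lemma list_prod_mem {l : List G} (hl : ∀ x ∈ l, x ∈ coordinateBall ψ r) :
    l.prod ∈ coordinateBall ψ r := by
  induction l with
  | nil => simpa using h.one_mem
  | cons x l ih =>
    rw [List.prod_cons]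
    exact h.mul_mem (hl x (by simp)) (ih fun y hy => hl y (by simp [hy]))

/-- By the ultrametric inequality the errors of the `k` multiplications do not accumulate. -/
lemma norm_pow_sub_smul_le {g : G} (hg : g ∈ coordinateBall ψ r) (k : ℕ) :
    ‖ψ (g ^ k) - (k : ℚ_[p]) • ψ g‖ ≤ (p : ℝ)⁻¹ ^ 2 * ‖ψ g‖ := by
  induction k with
  | zero =>
    simp only [pow_zero, h.map_one, Nat.cast_zero, zero_smul, sub_zero, norm_zero]
    positivity
  | succ k ih =>
    have : ψ (g ^ (k + 1)) - ((k + 1 : ℕ) : ℚ_[p]) • ψ g =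
        (ψ (g ^ k * g) - ψ (g ^ k) - ψ g) + (ψ (g ^ k) - (k : ℚ_[p]) • ψ g) := by
      rw [pow_succ, Nat.cast_succ, add_smul, one_smul]
      abel
    rw [this]
    exact (IsUltrametricDist.norm_add_le_max _ _).trans
      (max_le (h.norm_mul_sub (h.pow_mem hg k) hg) ih)

/-- The error is small relative to `‖m‖`, by stripping factors `p` from `m`. A `p`-th power scales
the main term by `p⁻¹`, so the constant `p⁻²` still leaves a gain of `p⁻¹`. -/
lemma norm_pow_sub_smul_le_mul {g : G} (hg : g ∈ coordinateBall ψ r) (m : ℕ) :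
    ‖ψ (g ^ m) - (m : ℚ_[p]) • ψ g‖ ≤ (p : ℝ)⁻¹ * (‖(m : ℚ_[p])‖ * ‖ψ g‖) := by
  induction m using Nat.strong_induction_on with
  | _ m ih =>
    by_cases hm : p ∣ m
    · obtain ⟨n, rfl⟩ := hm
      rcases Nat.eq_zero_or_pos n with rfl | hn
      · simp [h.map_one]
      have ihn := ih n (lt_mul_of_one_lt_left hn (Fact.out : p.Prime).one_lt)
      have hle : ‖ψ (g ^ n)‖ ≤ ‖(n : ℚ_[p])‖ * ‖ψ g‖ := by
        refine norm_le_of_norm_sub_le (y := (n : ℚ_[p]) • ψ g)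
          (ihn.trans (mul_le_of_le_one_left (by positivity) ?_)) (norm_smul_le _ _)
        exact inv_le_one_of_one_le₀ (by exact_mod_cast (Fact.out : p.Prime).one_le)
      have : ψ (g ^ (p * n)) - ((p * n : ℕ) : ℚ_[p]) • ψ g =
          (ψ ((g ^ n) ^ p) - (p : ℚ_[p]) • ψ (g ^ n)) +
            (p : ℚ_[p]) • (ψ (g ^ n) - (n : ℚ_[p]) • ψ g) := by
        rw [← pow_mul, mul_comm n p, Nat.cast_mul, mul_smul, smul_sub]
        abel
      rw [this]
      refine (IsUltrametricDist.norm_add_le_max _ _).trans (max_le ?_ ?_)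
      · refine (h.norm_pow_sub_smul_le (h.pow_mem hg n) p).trans ?_
        rw [Nat.cast_mul, norm_mul, Padic.norm_p, sq, mul_assoc, mul_assoc]
        gcongr
      · rw [norm_smul, Nat.cast_mul, norm_mul, Padic.norm_p, mul_assoc]
        gcongr
    · have : ‖(m : ℚ_[p])‖ = 1 := by
        rw [Padic.norm_natCast_eq_one_iff]
        exact ((Fact.out : p.Prime).coprime_iff_not_dvd.2 hm)
      rw [this, one_mul]
      exact (h.norm_pow_sub_smul_le hg m).trans (by gcongr; exact inv_sq_le_inv)

lemma norm_pow_le {g : G} (hg : g ∈ coordinateBall ψ r) (m : ℕ) :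
    ‖ψ (g ^ m)‖ ≤ ‖(m : ℚ_[p])‖ * ‖ψ g‖ := by
  refine norm_le_of_norm_sub_le (y := (m : ℚ_[p]) • ψ g)
    ((h.norm_pow_sub_smul_le_mul hg m).trans (mul_le_of_le_one_left (by positivity) ?_))
    (norm_smul_le _ _)
  exact inv_le_one_of_one_le₀ (by exact_mod_cast (Fact.out : p.Prime).one_le)

/-- First-order effect of perturbing every factor of a product; this is where the estimate on
differences, and not only near-additivity, is needed. -/
lemma norm_list_prod_sub {ι : Type*} (l : List ι) (u v : ι → G)
    (hu : ∀ i, u i ∈ coordinateBall ψ r) (hv : ∀ i, v i ∈ coordinateBall ψ r) {t : ℝ} (ht : 0 ≤ t)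
    (hvt : ∀ i, ‖ψ (v i)‖ ≤ t) :
    ‖ψ (l.map fun i => u i * v i).prod - ψ (l.map u).prod - (l.map fun i => ψ (v i)).sum‖ ≤
      (p : ℝ)⁻¹ ^ 2 * t := by
  induction l with
  | nil => simpa using by positivity
  | cons i l ih =>
    simp only [List.map_cons, List.prod_cons, List.sum_cons]
    have hP : (l.map u).prod ∈ coordinateBall ψ r :=
      h.list_prod_mem (by simpa using fun j _ => hu j)
    have hP' : (l.map fun i => u i * v i).prod ∈ coordinateBall ψ r :=
      h.list_prod_mem (by simpa using fun j _ => h.mul_mem (hu j) (hv j))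
    have hsum : ‖(l.map fun i => ψ (v i)).sum‖ ≤ t := by
      clear ih hP hP'
      induction l with
      | nil => simpa using ht
      | cons j l ih =>
        rw [List.map_cons, List.sum_cons]
        exact (IsUltrametricDist.norm_add_le_max _ _).trans (max_le (hvt j) ih)
    have h1 : ‖ψ (u i * v i) - ψ (u i) - ψ (v i)‖ ≤ (p : ℝ)⁻¹ ^ 2 * t :=
      (h.norm_mul_sub (hu i) (hv i)).trans (by gcongr; exact hvt i)
    have hle : (p : ℝ)⁻¹ ^ 2 * t ≤ t := mul_le_of_le_one_left ht inv_sq_le_one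
    have h2 : ‖ψ (u i * v i) - ψ (u i)‖ ≤ t := norm_le_of_norm_sub_le (h1.trans hle) (hvt i)
    have h3 : ‖ψ (l.map fun i => u i * v i).prod - ψ (l.map u).prod‖ ≤ t :=
      norm_le_of_norm_sub_le (ih.trans hle) hsum
    have h4 := (h.norm_mul_sub_mul (h.mul_mem (hu i) (hv i)) hP' (hu i) hP).trans
      (mul_le_mul_of_nonneg_left (max_le h2 h3) (by positivity))
    have e : ∀ A B C D E F H K : Fin d → ℚ_[p], A - B - (C + D) =
      (A - B - ((E - F) + (H - K))) + ((E - F - C) + (H - K - D)) := by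
      intros; abel
    rw [e _ _ _ _ (ψ (u i * v i)) (ψ (u i)) (ψ (l.map fun i => u i * v i).prod)
      (ψ (l.map u).prod)]
    exact (IsUltrametricDist.norm_add_le_max _ _).trans (max_le h4
      ((IsUltrametricDist.norm_add_le_max _ _).trans (max_le h1 ih)))

end IsAlmostAdditive

/-- Products of powers of elements with coordinates `c • eᵢ` approximate all elements of a
sufficiently small ball. -/
lemma IsAlmostAdditive.exists_norm_list_prod_sub_le
    {ψ : OpenPartialHomeomorph G (Fin d → ℚ_[p])} {c : ℚ_[p]} (h : IsAlmostAdditive ψ ‖c‖)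
    {g : Fin d → G} (hg : ∀ i, g i ∈ coordinateBall ψ ‖c‖)
    (hgc : ∀ i, ψ (g i) = Pi.single i c) (m : ℕ) {y : Fin d → ℚ_[p]}
    (hy : ‖y‖ ≤ ‖(m : ℚ_[p])‖ * ‖c‖) (n : ℕ) :
    ∃ a : Fin d → ℕ, ‖ψ ((List.finRange d).map fun i => (g i ^ m) ^ a i).prod - y‖ ≤
      (p : ℝ)⁻¹ ^ n * (‖(m : ℚ_[p])‖ * ‖c‖) := by
  induction n with
  | zero =>
    refine ⟨0, ?_⟩
    have : ((List.finRange d).map fun i => (g i ^ m) ^ (0 : Fin d → ℕ) i).prod = 1 :=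
      List.prod_eq_one (by simp)
    simpa [this, h.map_one] using hy
  | succ n ih =>
    obtain ⟨a, ha⟩ := ih
    set x := ψ ((List.finRange d).map fun i => (g i ^ m) ^ a i).prod with hx
    have hnorm : ‖((m * p ^ n : ℕ) : ℚ_[p]) * c‖ = (p : ℝ)⁻¹ ^ n * (‖(m : ℚ_[p])‖ * ‖c‖) := by
      simp only [Nat.cast_mul, Nat.cast_pow, norm_mul, norm_pow, Padic.norm_p]
      ring
    -- The next `p`-adic digit: each coordinate of the remainder `y - x` is matched, up to a factor
    -- `p⁻¹`, by a multiple of `m pⁿ c`.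
    have hb : ∀ i, ∃ b : ℕ, ‖(b : ℚ_[p]) * (((m * p ^ n : ℕ) : ℚ_[p]) * c) - (y - x) i‖ ≤
        (p : ℝ)⁻¹ * ((p : ℝ)⁻¹ ^ n * (‖(m : ℚ_[p])‖ * ‖c‖)) := fun i => by
      rw [← hnorm]
      refine Padic.exists_nat_norm_sub_mul_le ((norm_le_pi_norm _ i).trans ?_)
      rwa [hnorm, norm_sub_rev]
    choose b hb using hb
    have hpow : ∀ i, ((g i ^ m) ^ (p ^ n * b i)) = g i ^ (m * p ^ n * b i) := fun i => by
      rw [← pow_mul, mul_assoc]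
    have hnb : ∀ i, ‖((m * p ^ n * b i : ℕ) : ℚ_[p])‖ * ‖c‖ ≤
        (p : ℝ)⁻¹ ^ n * (‖(m : ℚ_[p])‖ * ‖c‖) := fun i => by
      rw [← hnorm, norm_mul, Nat.cast_mul (m * p ^ n), norm_mul, mul_right_comm]
      exact mul_le_of_le_one_right (by positivity) (by exact_mod_cast Padic.norm_int_le_one (b i))
    have hnc : ∀ i, ‖ψ (g i)‖ = ‖c‖ := fun i => by rw [hgc, Pi.norm_single]
    refine ⟨fun i => a i + p ^ n * b i, ?_⟩
    have key := h.norm_list_prod_sub (List.finRange d) (fun i => (g i ^ m) ^ a i)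
      (fun i => (g i ^ m) ^ (p ^ n * b i)) (fun i => h.pow_mem (h.pow_mem (hg i) _) _)
      (fun i => h.pow_mem (h.pow_mem (hg i) _) _)
      (t := (p : ℝ)⁻¹ ^ n * (‖(m : ℚ_[p])‖ * ‖c‖)) (by positivity) (fun i => by
        rw [hpow]
        refine (h.norm_pow_le (hg i) _).trans ?_
        rw [hnc]
        exact hnb i)
    simp only [← pow_add, ← hx] at key
    set z := ψ ((List.finRange d).map fun i => (g i ^ m) ^ (a i + p ^ n * b i)).prod
    have hsum : ((List.finRange d).map fun i => ψ ((g i ^ m) ^ (p ^ n * b i))).sum =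
        ∑ i, ψ ((g i ^ m) ^ (p ^ n * b i)) := by
      rw [Fin.sum_univ_def]
    have e : z - y = (z - x - ∑ i, ψ ((g i ^ m) ^ (p ^ n * b i))) +
        ∑ i, (ψ ((g i ^ m) ^ (p ^ n * b i)) - Pi.single i ((y - x) i)) := by
      rw [Finset.sum_sub_distrib, Finset.univ_sum_single]
      abel
    rw [e, pow_succ', mul_assoc]
    refine (IsUltrametricDist.norm_add_le_max _ _).trans (max_le ?_ ?_)
    · rw [← hsum]
      refine key.trans ?_
      gcongr
      exact inv_sq_le_inv
    · refine IsUltrametricDist.norm_sum_le_of_forall_le_of_nonneg (by positivity) fun i _ => ?_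
      have e2 : ψ ((g i ^ m) ^ (p ^ n * b i)) - Pi.single i ((y - x) i) =
          (ψ (g i ^ (m * p ^ n * b i)) - ((m * p ^ n * b i : ℕ) : ℚ_[p]) • ψ (g i)) +
          Pi.single i ((b i : ℚ_[p]) * (((m * p ^ n : ℕ) : ℚ_[p]) * c) - (y - x) i) := by
        rw [hpow, hgc, ← Pi.single_smul, Pi.single_sub, smul_eq_mul, Nat.cast_mul (m * p ^ n),
          mul_comm (((m * p ^ n : ℕ) : ℚ_[p])) (b i : ℚ_[p]), mul_assoc (b i : ℚ_[p])]
        abel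
      rw [e2]
      refine (IsUltrametricDist.norm_add_le_max _ _).trans (max_le ?_ ?_)
      · refine (h.norm_pow_sub_smul_le_mul (hg i) _).trans ?_
        rw [hnc]
        exact mul_le_mul_of_nonneg_left (hnb i) (by positivity)
      · rw [Pi.norm_single]
        exact hb i

end

/-! ### Procyclic subgroups generate a neighbourhood of the identity -/

section

variable {p : ℕ} [Fact p.Prime] {d : ℕ} {G : Type*} [Group G] [TopologicalSpace G]
  {ψ : OpenPartialHomeomorph G (Fin d → ℚ_[p])}

omit [Group G] in
lemma exists_forall_norm_sub_lt_mem {x : G} (hx : x ∈ ψ.source) {O : Set G} (hO : O ∈ nhds x) :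
    ∃ δ > 0, ∀ y ∈ ψ.source, ‖ψ y - ψ x‖ < δ → y ∈ O := by
  have hc : ∀ᶠ z in nhds (ψ x), ψ.symm z ∈ O :=
    (ψ.symm.continuousAt (ψ.map_source hx)).eventually_mem (by rwa [ψ.left_inv hx])
  obtain ⟨δ, hδ, H⟩ := Metric.eventually_nhds_iff.1 hc
  refine ⟨δ, hδ, fun y hy hxy => ?_⟩
  simpa [ψ.left_inv hy] using H (y := ψ y) (by rwa [dist_eq_norm])

namespace IsAlmostAdditive

variable {r : ℝ} (h : IsAlmostAdditive ψ r)
include h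

lemma isCompact_coordinateBall : IsCompact (coordinateBall ψ r) := by
  have : coordinateBall ψ r = ψ.symm '' Metric.closedBall 0 r := by
    ext x
    constructor
    · exact fun hx => ⟨ψ x, by simpa using hx.2, ψ.left_inv hx.1⟩
    · rintro ⟨z, hz, rfl⟩
      have hzt := h.closedBall_subset hz
      exact ⟨ψ.map_target hzt, by simpa [ψ.right_inv hzt] using hz⟩
  rw [this]
  exact (isCompact_closedBall _ _).image_of_continuousOn
    (ψ.symm.continuousOn.mono h.closedBall_subset)

lemma coordinateBall_mem_nhds {s : ℝ} (hs : 0 < s) : coordinateBall ψ s ∈ nhds 1 := by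
  have hc : Filter.Tendsto ψ (nhds 1) (nhds 0) := h.map_one ▸ ψ.continuousAt h.one_mem_source
  filter_upwards [ψ.open_source.mem_nhds h.one_mem_source,
    hc (Metric.closedBall_mem_nhds 0 hs)] with x hx hxs
  exact ⟨hx, by simpa using hxs⟩

lemma closure_powers_subset [T2Space G] {g : G} (hg : g ∈ coordinateBall ψ r) :
    closure (Submonoid.powers g : Set G) ⊆ coordinateBall ψ r := by
  refine closure_minimal ?_ h.isCompact_coordinateBall.isClosed
  rintro _ ⟨k, rfl⟩
  exact h.pow_mem hg k

/-- The powers of `g` with exponent `pⁿ` tend to the identity. -/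
lemma exists_pow_mem {g : G} (hg : g ∈ coordinateBall ψ r) {O : Set G} (hO : O ∈ nhds 1) :
    ∃ n > 0, g ^ n ∈ O := by
  obtain ⟨δ, hδ, H⟩ := exists_forall_norm_sub_lt_mem h.one_mem_source hO
  have hp : (p : ℝ)⁻¹ < 1 := inv_lt_one_of_one_lt₀ (by exact_mod_cast (Fact.out : p.Prime).one_lt)
  have ht := (tendsto_pow_atTop_nhds_zero_of_lt_one (by positivity) hp).mul_const ‖ψ g‖
  rw [zero_mul] at ht
  obtain ⟨n, hn⟩ := (ht.eventually_lt_const hδ).exists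
  refine ⟨p ^ n, pow_pos (Fact.out : p.Prime).pos n, H _ (h.pow_mem hg _).1 ?_⟩
  rw [h.map_one, sub_zero]
  refine (h.norm_pow_le hg _).trans_lt ?_
  simpa using hn

open scoped Pointwise in
omit h in
/-- A subgroup containing, for each element `g` near the identity, the closure of the powers of
some power of `g`, is a neighbourhood of the identity. -/
lemma subgroup_mem_nhds_one [IsTopologicalGroup G] [T2Space G] {c : ℚ_[p]}
    (h : IsAlmostAdditive ψ ‖c‖) (hc : c ≠ 0) (S : Subgroup G)
    (hS : ∀ g ∈ coordinateBall ψ ‖c‖, ∃ m > 0,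
      closure (Submonoid.powers (g ^ m) : Set G) ⊆ S) :
    (S : Set G) ∈ nhds 1 := by
  let g : Fin d → G := fun i => ψ.symm (Pi.single i c)
  have ht : ∀ i : Fin d, (Pi.single i c : Fin d → ℚ_[p]) ∈ ψ.target := fun i =>
    h.closedBall_subset (by simp [Pi.norm_single])
  have hgc : ∀ i, ψ (g i) = Pi.single i c := fun i => ψ.right_inv (ht i)
  have hg : ∀ i, g i ∈ coordinateBall ψ ‖c‖ := fun i =>
    ⟨ψ.map_target (ht i), by rw [hgc, Pi.norm_single]⟩
  choose m hm0 hm using fun i => hS (g i) (hg i)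
  -- One exponent serving all `d` axes, since every `m i` divides it.
  set M := ∏ i, m i
  have hM : M ≠ 0 := Finset.prod_ne_zero_iff.2 fun i _ => (hm0 i).ne'
  let A : Fin d → Set G := fun i => closure (Submonoid.powers (g i ^ M) : Set G)
  have hAS : ∀ i, A i ⊆ S := fun i => by
    obtain ⟨n, hn⟩ : m i ∣ M := Finset.dvd_prod_of_mem m (Finset.mem_univ i)
    refine (closure_mono ?_).trans (hm i)
    rintro _ ⟨k, rfl⟩
    exact ⟨n * k, by simp only [hn, pow_mul]⟩
  have hAc : ∀ i, IsCompact (A i) := fun i =>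
    h.isCompact_coordinateBall.of_isClosed_subset isClosed_closure
      (h.closure_powers_subset (h.pow_mem (hg i) M))
  -- `S` is not known to be closed, but this product of compact subsets of it is, so it contains the
  -- limits of the approximating products.
  have hPc : ∀ l : List (Fin d), IsCompact (l.map A).prod := fun l => by
    induction l with
    | nil => exact isCompact_singleton
    | cons i l ih => exact (hAc i).mul ih
  have hPS : ∀ l : List (Fin d), (l.map A).prod ⊆ (S : Set G) := fun l => by
    induction l with
    | nil => exact Set.singleton_subset_iff.2 S.one_mem
    | cons i l ih => exact Set.mul_subset_iff.2 fun x hx y hy => S.mul_mem (hAS i hx) (ih hy)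
  have hPm : ∀ (a : Fin d → ℕ) (l : List (Fin d)),
      (l.map fun i => (g i ^ M) ^ a i).prod ∈ (l.map A).prod := fun a l => by
    induction l with
    | nil => exact Set.mem_singleton _
    | cons i l ih => exact Set.mul_mem_mul (subset_closure ⟨a i, rfl⟩) ih
  have hpos : 0 < ‖(M : ℚ_[p])‖ * ‖c‖ := by
    have : (M : ℚ_[p]) ≠ 0 := Nat.cast_ne_zero.2 hM
    positivity
  refine Filter.mem_of_superset (h.coordinateBall_mem_nhds hpos) fun x hx => ?_
  refine hPS (List.finRange d) ?_
  rw [← (hPc (List.finRange d)).isClosed.closure_eq, mem_closure_iff_nhds]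
  intro O hO
  obtain ⟨δ, hδ, H⟩ := exists_forall_norm_sub_lt_mem hx.1 hO
  have hp : (p : ℝ)⁻¹ < 1 := inv_lt_one_of_one_lt₀ (by exact_mod_cast (Fact.out : p.Prime).one_lt)
  have ht0 := (tendsto_pow_atTop_nhds_zero_of_lt_one (by positivity) hp).mul_const
    (‖(M : ℚ_[p])‖ * ‖c‖)
  rw [zero_mul] at ht0
  obtain ⟨n, hn⟩ := (ht0.eventually_lt_const hδ).exists
  obtain ⟨a, ha⟩ := h.exists_norm_list_prod_sub_le hg hgc M hx.2 n
  refine ⟨_, H _ (h.list_prod_mem ?_).1 (ha.trans_lt hn), hPm a _⟩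
  simpa using fun i => h.pow_mem (h.pow_mem (hg i) _) _

end IsAlmostAdditive

end

/-! ### Stabilizers and cocycles on procyclic groups -/

section

variable {k : Type*} {G : Type*} [Field k] [Group G] {E : Type*} [AddCommGroup E] [Module k E]

/-- The stabilizer of a vector of a representation. -/
def Representation.fixer (ρ : Representation k G E) (x : E) : Subgroup G where
  carrier := {g | ρ g x = x}
  one_mem' := by simp
  mul_mem' {a b} ha hb := by
    simp only [Set.mem_ofPred_eq] at ha hb ⊢
    rw [map_mul, Module.End.mul_apply, hb, ha]
  inv_mem' {a} ha := by
    simp only [Set.mem_ofPred_eq] at ha ⊢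
    nth_rw 1 [← ha]
    rw [← Module.End.mul_apply, ← map_mul, inv_mul_cancel, map_one, Module.End.one_apply]

namespace Representation

variable (ρ : Representation k G E)

@[simp]
lemma mem_fixer {x : E} {g : G} : g ∈ ρ.fixer x ↔ ρ g x = x := Iff.rfl

variable [TopologicalSpace G]

lemma isLocallyConstant_orbit_iff [IsTopologicalGroup G] (x : E) :
    (IsLocallyConstant fun g => ρ g x) ↔ (ρ.fixer x : Set G) ∈ nhds 1 := by
  constructor
  · intro hx
    refine (hx.isOpen_fiber x).mem_nhds ?_
    simp
  · intro hx
    have ho := Subgroup.isOpen_of_mem_nhds _ hx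
    refine (IsLocallyConstant.iff_exists_open _).2 fun g => ⟨(fun a => g⁻¹ * a) ⁻¹' (ρ.fixer x),
      ho.preimage (continuous_const_mul g⁻¹), ?_, fun a ha => ?_⟩
    · simp
    · have : ρ (g⁻¹ * a) x = x := ha
      nth_rw 2 [← this]
      rw [← Module.End.mul_apply, ← map_mul, mul_inv_cancel_left]

/-- If `k` has positive characteristic and the cocycle `a ↦ ρ a x - x` takes values in smooth
vectors on the procyclic group generated by `g`, then it vanishes on the procyclic group generated
by some power of `g`. -/
lemma exists_closure_powers_subset_fixer [IsTopologicalGroup G] [T2Space G] {ℓ : ℕ} [CharP k ℓ]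
    (hℓ : 0 < ℓ) {x : E} {g : G} (hc : IsCompact (closure (Submonoid.powers g : Set G)))
    (hpow : ∀ O ∈ nhds (1 : G), ∃ n > 0, g ^ n ∈ O)
    (hx : ∀ a ∈ closure (Submonoid.powers g : Set G),
      IsLocallyConstant fun b => ρ b (ρ a x - x)) :
    ∃ m > 0, closure (Submonoid.powers (g ^ m) : Set G) ⊆ ρ.fixer x := by
  -- Open subgroups are closed, so a stabilizer containing `g` contains the whole procyclic closure.
  have hsm : ∀ a ∈ closure (Submonoid.powers g : Set G),
      IsClosed (ρ.fixer (ρ a x - x) : Set G) := fun a ha =>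
    Subgroup.isClosed_of_isOpen _ (Subgroup.isOpen_of_mem_nhds _
      ((ρ.isLocallyConstant_orbit_iff _).1 (hx a ha)))
  have hgA : g ∈ closure (Submonoid.powers g : Set G) :=
    subset_closure (Submonoid.mem_powers g)
  have hclos : ∀ {a : G} {F : Subgroup G}, IsClosed (F : Set G) → a ∈ F →
      closure (Submonoid.powers a : Set G) ⊆ F := fun {a F} hF ha => by
    refine closure_minimal ?_ hF
    rintro _ ⟨n, rfl⟩
    exact F.pow_mem ha n
  obtain ⟨N, hN, hgN⟩ := hpow _ ((ρ.isLocallyConstant_orbit_iff _).1 (hx g hgA))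
  set B := closure (Submonoid.powers (g ^ N) : Set G) with hB
  have hBA : B ⊆ closure (Submonoid.powers g : Set G) := by
    refine closure_mono ?_
    rintro _ ⟨n, rfl⟩
    exact ⟨N * n, by simp only [pow_mul]⟩
  have hBw : B ⊆ ρ.fixer (ρ g x - x) := hclos (hsm g hgA) hgN
  have hcomm : ∀ b ∈ B, g * b = b * g := fun b hb => by
    have : closure (Submonoid.powers g : Set G) ⊆ Set.centralizer {g} := by
      refine closure_minimal ?_ (Set.isClosed_centralizer _)
      rintro _ ⟨n, rfl⟩
      simpa [Set.mem_centralizer_iff] using (pow_succ' g n).symm.trans (pow_succ g n)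
    exact Set.mem_centralizer_iff.1 (this (hBA hb)) g rfl
  -- As `b` commutes with `g` and fixes `ρ g x - x`, symmetrically `g` fixes `ρ b x - x`; hence so
  -- does `b`, a limit of powers of `g`.
  have hBfix : ∀ b ∈ B, ρ b (ρ b x - x) = ρ b x - x := fun b hb => by
    refine hclos (hsm b (hBA hb)) ?_ (hBA hb)
    have h1 : ρ b (ρ g x - x) = ρ g x - x := hBw hb
    have h2 : ρ g (ρ b x) = ρ b (ρ g x) := by
      rw [← Module.End.mul_apply, ← map_mul, hcomm b hb, map_mul, Module.End.mul_apply]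
    rw [mem_fixer, map_sub, h2, sub_eq_sub_iff_sub_eq_sub, ← map_sub, h1]
  have hsum : ∀ b ∈ B, ∀ n : ℕ, ρ (b ^ n) x = x + (n : k) • (ρ b x - x) := fun b hb n => by
    induction n with
    | zero => simp
    | succ n ih =>
      rw [pow_succ', map_mul, Module.End.mul_apply, ih, map_add, map_smul, hBfix b hb,
        Nat.cast_succ, add_smul, one_smul]
      abel
  -- Compactness makes the set of `ℓ`-th powers closed, so every limit of powers of `g ^ (N * ℓ)` is
  -- itself an `ℓ`-th power from `B`.
  have himg : closure (Submonoid.powers (g ^ (N * ℓ)) : Set G) ⊆ (fun b => b ^ ℓ) '' B := by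
    have hBc : IsCompact B := hc.of_isClosed_subset isClosed_closure hBA
    refine closure_minimal ?_ (hBc.image (continuous_pow ℓ)).isClosed
    rintro _ ⟨n, rfl⟩
    refine ⟨(g ^ N) ^ n, subset_closure ⟨n, rfl⟩, ?_⟩
    simp only [← pow_mul]
    ring_nf
  refine ⟨N * ℓ, Nat.mul_pos hN hℓ, fun a ha => ?_⟩
  obtain ⟨b, hb, rfl⟩ := himg ha
  change ρ (b ^ ℓ) x = x
  rw [hsum b hb, CharP.cast_eq_zero, zero_smul, add_zero]

end Representation

end

/-! ### Closure under extensions and conclusion -/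

/-- Over a field of positive characteristic, an extension of smooth representations of a `p`-adic
Lie group is smooth. -/
lemma smoothProperty_isClosedUnderExtensions (p : ℕ) [Fact p.Prime] (d : ℕ)
    (G : Type v) [Group G] [TopologicalSpace G] [ChartedSpace (Fin d → ℚ_[p]) G]
    [LieGroup 𝓘(ℚ_[p], Fin d → ℚ_[p]) ω G]
    (k : Type u) [Field k] (ℓ : ℕ) [CharP k ℓ] (hℓ : 0 < ℓ) :
    (smoothProperty.{w} k G).IsClosedUnderExtensions where
  prop_X₂_of_shortExact {S} hS h₁ h₃ := by
    have : IsTopologicalGroup G := topologicalGroup_of_lieGroup 𝓘(ℚ_[p], Fin d → ℚ_[p]) ω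
    have : T1Space G := ChartedSpace.t1Space (Fin d → ℚ_[p]) G
    rw [smoothProperty_iff] at h₁ h₃ ⊢
    intro x
    have hex : ∀ y : S.X₂, S.g.hom y = 0 → ∃ z : S.X₁, S.f.hom z = y := by
      have := hS.exact.map (forget₂ (Rep.{w} k G) (ModuleCat.{w} k))
      exact (ShortComplex.moduleCat_exact_iff _).1 this
    -- The ball is chosen to fix the image of `x` in the quotient, so that `ρ a x - x` comes from
    -- the subrepresentation.
    obtain ⟨ψ, c, hc, h, hU⟩ := LieGroup.exists_isAlmostAdditive (p := p) (d := d)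
      ((Representation.isLocallyConstant_orbit_iff _ _).1 (h₃ (S.g.hom x)))
    refine (Representation.isLocallyConstant_orbit_iff _ _).2 (h.subgroup_mem_nhds_one hc _
      fun g hg => Representation.exists_closure_powers_subset_fixer _ hℓ
        (h.isCompact_coordinateBall.of_isClosed_subset isClosed_closure
          (h.closure_powers_subset hg)) (fun O hO => h.exists_pow_mem hg hO) fun a ha => ?_)
    have ha' : S.X₃.ρ a (S.g.hom x) = S.g.hom x := hU (h.closure_powers_subset hg ha)
    obtain ⟨z, hz⟩ := hex (S.X₂.ρ a x - x) (by
      rw [map_sub, Rep.hom_comm_apply, ha', sub_self])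
    rw [← hz]
    have : (fun b => S.X₂.ρ b (S.f.hom z)) = S.f.hom ∘ fun b => S.X₁.ρ b z :=
      funext fun b => (Rep.hom_comm_apply S.f b z).symm
    rw [this]
    exact (h₁ z).comp _

theorem corollary4p5 (p : ℕ) [Fact p.Prime] (d : ℕ)
    (G : Type v) [Group G] [TopologicalSpace G] [ChartedSpace (Fin d → ℚ_[p]) G]
    [LieGroup 𝓘(ℚ_[p], Fin d → ℚ_[p]) ω G]
    (k : Type u) [Field k] (ℓ : ℕ) [CharP k ℓ] (hℓ : 0 < ℓ)
    [HasExt.{w₁} (SmoothRep.{w} k G)] [HasExt.{w₂} (Rep.{w} k G)]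
    (V W : SmoothRep.{w} k G) :
    Function.Bijective ((smoothProperty.{w} k G).ι.mapExtLinearMap k V W 1) := by
  have := smoothProperty_isClosedUnderExtensions.{w} p d G k ℓ hℓ
  exact ⟨mapExactFunctor_one_injective _ V W, mapExactFunctor_one_surjective _ V W⟩
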